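/- Let $\Sigma=\{0,1\}^{\mathbb Z}$ be the full two-sided shift on two symbols, with the left shift $T$, and let $\mu$ be a $T$-invariant ergodic probability measure on $\Sigma$ of full support. Let $(u_n)_{n\ge 0}$ be any sequence of positive real numbers tending to $0$. For $M:\Sigma\to SL(2,\mathbb R)$ write $M^n(x)=M(T^{n-1}x)\cdots M(Tx)M(x)$, let $\|\cdot\|$ be the operator norm associated with the Euclidean norm on $\mathbb R^2$, and let $\lambda_+(M)$ denote the top Lyapunov exponent of $M$, i.e. the real number such that $\frac1n\log\|M^n(x)\|\to\lambda_+(M)$ for $\mu$-almost every $x$. Then there exists a continuous map $M:\Sigma\to SL(2,\mathbb R)$ with $\lambda_+(M)>0$ such that, for infinitely many values of $n$, $$\mu\{x : \log\|M^n(x)\|\le n\lambda_+(M)/2\}\ge u_n.$$ Moreover, if $u_n$ tends to zero slower than exponentially (that is, $u_n e^{cn}\to\infty$ for every $c>0$; for instance $u_n=1/(n+1)$), then this cocycle $M$ does not have exponential large deviations for its top exponent: it is not true that for every $\epsilon>0$ there exists $C>0$ such that, for all $n\ge 0$, $\mu\{x : |\log\|M^n(x)\|-n\lambda_+(M)|\ge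 n\epsilon\}\le Ce^{-C^{-1}n}$. -/

import Mathlib

open Filter Topology MeasureTheory

/-- The (bilateral) full shift space on two symbols, with the product topology
and the product σ-algebra. -/
abbrev TwoShift : Type := ℤ → Fin 2

/-- The left shift map `(T x)_k = x_{k+1}`. -/
def twoShiftMap (x : TwoShift) : TwoShift := fun k => x (k + 1)

/-- The iterates of the linear cocycle generated by `M` above `T`:
`M^n(x) = M(T^{n-1} x) ⋯ M(T x) M(x)`, with `M^0(x) = Id`. -/
def cocycleIter {X G : Type*} [Monoid G] (T : X → X) (M : X → G) : ℕ → X → G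
  | 0, _ => 1
  | n + 1, x => M (T^[n] x) * cocycleIter T M n x

/-- The operator norm, for the Euclidean norm on `ℝ²`, of a matrix in `SL(2, ℝ)`. -/
noncomputable def slNorm (A : Matrix.SpecialLinearGroup (Fin 2) ℝ) : ℝ :=
  ‖Matrix.toEuclideanCLM (n := Fin 2) (𝕜 := ℝ) (A : Matrix (Fin 2) (Fin 2) ℝ)‖

/-- The functions `x ↦ log ‖M^n(x)‖`. -/
noncomputable def logNormIter {X : Type*} (T : X → X)
    (M : X → Matrix.SpecialLinearGroup (Fin 2) ℝ) (n : ℕ) (x : X) : ℝ :=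
  Real.log (slNorm (cocycleIter T M n x))

/-- `lam` is the top Lyapunov exponent of the cocycle `M` above `(T, μ)`:
`log ‖M^n(x)‖ / n → lam` for `μ`-almost every `x`. -/
def IsTopLyapunovExponent {X : Type*} [MeasurableSpace X] (T : X → X) (μ : Measure X)
    (M : X → Matrix.SpecialLinearGroup (Fin 2) ℝ) (lam : ℝ) : Prop :=
  ∀ᵐ x ∂μ, Tendsto (fun n : ℕ => logNormIter T M n x / n) atTop (𝓝 lam)

/-- A family of functions `f n`, with `f n x / n → lam` almost everywhere, has exponential
large deviations if for every `ε > 0` there is `C > 0` such that, for all `n`,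
`μ {x | |f n x - n lam| ≥ n ε} ≤ C exp (-n / C)`.
The almost everywhere convergence is stated separately where this is used. -/
def HasExpLargeDeviations {X : Type*} [MeasurableSpace X] (μ : Measure X)
    (f : ℕ → X → ℝ) (lam : ℝ) : Prop :=
  ∀ ε : ℝ, 0 < ε → ∃ C : ℝ, 0 < C ∧ ∀ n : ℕ,
    μ {x | |f n x - n * lam| ≥ n * ε} ≤ ENNReal.ofReal (C * Real.exp (-(C⁻¹ * n)))

/-!
Let `A` be a clopen set. Take the cocycle equal to a fixed hyperbolic diagonal matrix on `A` and to
the identity off `A`, and twist it by rotations through an angle `ψ ∘ T - ψ`, where on `A` the phase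
`ψ` is a multiple of `π / 2` with `ψ ∘ T = ψ`. Rotation by `ψ` conjugates the twisted cocycle to a
diagonal one, so `log ‖Mⁿ‖` is the absolute value of a Birkhoff sum of a potential with values
`±1` on `A` and `0` off `A`, whose sign on `A` is `cos (2 ψ)`.

The potential can be modified with a continuous `ψ` of arbitrarily small increment: full support
provides orbit segments avoiding `A` of any length, along which `ψ` moves slowly between `0` and
`π / 2`. Poincaré recurrence and a Rokhlin tower with clopen base `Q` place two such segments at
times `0` and `n`; the modification then flips the sign of the potential between them, so the
Birkhoff sum `S n` of an orbit starting at height `i` becomes `S n - 2 S (n - i)`. By Birkhoff's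
theorem this is small compared with `n` when `i` is close to `n / 2`, and the set of such starting
points has a measure bounded below independently of `n`, hence eventually above `2 u n`.

Iterating with rapidly decreasing increments and supports produces such deviations at infinitely
many times, while the integral of the potential, which is the Lyapunov exponent, stays positive.
The sum of the angles is only measurable, but the sum of their increments converges uniformly, so
the limit cocycle is continuous.
-/

section Birkhoff

variable {X : Type*} {T : X → X} {f : X → ℝ}

/-- The maximum `max (0, S_1 f, …, S_n f)` of the first Birkhoff sums, written as the recursion
`F_{n+1} = max (0, f + F_n ∘ T)` that the maximal ergodic theorem exploits. -/
noncomputable def birkhoffMax (T : X → X) (f : X → ℝ) : ℕ → X → ℝ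
  | 0, _ => 0
  | n + 1, x => max 0 (f x + birkhoffMax T f n (T x))

theorem birkhoffMax_nonneg (n : ℕ) (x : X) : 0 ≤ birkhoffMax T f n x := by
  cases n with
  | zero => exact le_rfl
  | succ n => exact le_max_left _ _

theorem birkhoffMax_le_succ (n : ℕ) (x : X) :
    birkhoffMax T f n x ≤ birkhoffMax T f (n + 1) x := by
  induction n generalizing x with
  | zero => exact birkhoffMax_nonneg 1 x
  | succ n ih => exact max_le_max_left 0 (add_le_add_right (ih (T x)) (f x))

theorem birkhoffSum_le_birkhoffMax {k n : ℕ} (hkn : k ≤ n) (x : X) :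
    birkhoffSum T f k x ≤ birkhoffMax T f n x := by
  induction n generalizing k x with
  | zero => simp [Nat.le_zero.1 hkn, birkhoffMax]
  | succ n ih =>
    cases k with
    | zero => exact birkhoffMax_nonneg _ _
    | succ k =>
      rw [birkhoffSum_succ']
      exact le_max_of_le_right (add_le_add_right (ih (Nat.le_of_succ_le_succ hkn) (T x)) (f x))

theorem abs_birkhoffMax_succ_sub_comp_le (n : ℕ) (x : X) :
    |birkhoffMax T f (n + 1) x - birkhoffMax T f n (T x)| ≤ |f x| := by
  rw [birkhoffMax, ← max_sub_sub_right, zero_sub, add_sub_cancel_right, abs_le]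
  have hnonneg := birkhoffMax_nonneg (T := T) (f := f) n (T x)
  exact ⟨(neg_abs_le _).trans (le_max_right _ _),
    max_le (by linarith [abs_nonneg (f x)]) (le_abs_self _)⟩

theorem bddAbove_range_birkhoffSum_comp_iff (x : X) :
    BddAbove (Set.range fun n => birkhoffSum T f n (T x)) ↔
      BddAbove (Set.range fun n => birkhoffSum T f n x) := by
  simp only [bddAbove_def, Set.forall_mem_range]
  constructor
  · rintro ⟨K, hK⟩
    refine ⟨max 0 (f x + K), fun n => ?_⟩
    cases n with
    | zero => exact le_max_left _ _
    | succ n =>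
      rw [birkhoffSum_succ']
      exact le_max_of_le_right (add_le_add_right (hK n) (f x))
  · rintro ⟨K, hK⟩
    refine ⟨K - f x, fun n => ?_⟩
    have hsucc := hK (n + 1)
    rw [birkhoffSum_succ'] at hsucc
    linarith

theorem eventually_birkhoffMax_succ_sub_comp_eq {x : X}
    (hx : ¬ BddAbove (Set.range fun n => birkhoffSum T f n x)) :
    ∀ᶠ n in atTop, birkhoffMax T f (n + 1) x - birkhoffMax T f n (T x) = f x := by
  rw [← bddAbove_range_birkhoffSum_comp_iff, not_bddAbove_iff] at hx
  obtain ⟨_, ⟨k, rfl⟩, hk⟩ := hx (-f x)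
  filter_upwards [eventually_ge_atTop k] with n hn
  have hle := birkhoffSum_le_birkhoffMax (T := T) (f := f) hn (T x)
  rw [birkhoffMax, max_eq_right (by linarith only [hk, hle]), add_sub_cancel_right]

variable [MeasurableSpace X] {μ : Measure X}

theorem integrable_birkhoffSum (hT : MeasurePreserving T μ μ) (hf : Integrable f μ) (n : ℕ) :
    Integrable (birkhoffSum T f n) μ := by
  unfold birkhoffSum
  exact integrable_finsetSum _ fun k _ => (hT.iterate k).integrable_comp_of_integrable hf

theorem integrable_birkhoffMax (hT : MeasurePreserving T μ μ) (hf : Integrable f μ) (n : ℕ) :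
    Integrable (birkhoffMax T f n) μ := by
  induction n with
  | zero => exact integrable_zero _ _ _
  | succ n ih =>
    exact (integrable_zero X ℝ μ).sup (hf.add (hT.integrable_comp_of_integrable ih))

theorem integral_birkhoffMax_succ_sub_comp_nonneg (hT : MeasurePreserving T μ μ)
    (hf : Integrable f μ) (n : ℕ) :
    0 ≤ ∫ x, (birkhoffMax T f (n + 1) x - birkhoffMax T f n (T x)) ∂μ := by
  have hint := integrable_birkhoffMax hT hf
  have hcomp : ∫ x, birkhoffMax T f n (T x) ∂μ = ∫ x, birkhoffMax T f n x ∂μ := by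
    rw [← integral_map hT.aemeasurable (by rw [hT.map_eq]; exact (hint n).1), hT.map_eq]
  have hintT : Integrable (fun x => birkhoffMax T f n (T x)) μ :=
    hT.integrable_comp_of_integrable (hint n)
  rw [integral_sub (hint _) hintT, hcomp, sub_nonneg]
  exact integral_mono (hint _) (hint _) fun x => birkhoffMax_le_succ n x

theorem nullMeasurableSet_bddAbove_range {g : ℕ → X → ℝ} (hg : ∀ n, AEMeasurable (g n) μ) :
    NullMeasurableSet {x | BddAbove (Set.range fun n => g n x)} μ := by
  have heq : {x | BddAbove (Set.range fun n => g n x)} =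
      ⋃ K : ℕ, ⋂ n, {x | g n x ≤ K} := by
    ext x
    simp only [bddAbove_def, Set.forall_mem_range, Set.mem_ofPred_eq, Set.mem_iUnion,
      Set.mem_iInter]
    constructor
    · rintro ⟨K, hK⟩
      exact ⟨⌈K⌉₊, fun n => (hK n).trans (Nat.le_ceil K)⟩
    · rintro ⟨K, hK⟩
      exact ⟨K, hK⟩
  rw [heq]
  exact .iUnion fun K => .iInter fun n => nullMeasurableSet_le (hg n) aemeasurable_const

theorem integral_nonneg_of_ae_not_bddAbove_birkhoffSum (hT : MeasurePreserving T μ μ)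
    (hf : Integrable f μ)
    (h : ∀ᵐ x ∂μ, ¬ BddAbove (Set.range fun n => birkhoffSum T f n x)) : 0 ≤ ∫ x, f x ∂μ := by
  have hint := integrable_birkhoffMax hT hf
  refine ge_of_tendsto' (x := atTop) ?_ (integral_birkhoffMax_succ_sub_comp_nonneg hT hf)
  refine tendsto_integral_of_dominated_convergence (fun x => |f x|)
    (fun n => ((hint _).sub (hT.integrable_comp_of_integrable (hint n))).1) hf.abs
    (fun n => ae_of_all _ (abs_birkhoffMax_succ_sub_comp_le n)) ?_
  filter_upwards [h] with x hx
  exact tendsto_const_nhds.congr' ((eventually_birkhoffMax_succ_sub_comp_eq hx).mono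
    fun n hn => hn.symm)

theorem ae_bddAbove_birkhoffSum (hT : Ergodic T μ) (hf : Integrable f μ)
    (hneg : ∫ x, f x ∂μ < 0) :
    ∀ᵐ x ∂μ, BddAbove (Set.range fun n => birkhoffSum T f n x) := by
  have hmeas := nullMeasurableSet_bddAbove_range (μ := μ) fun n =>
    (integrable_birkhoffSum hT.toMeasurePreserving hf n).aemeasurable
  have hinv : T ⁻¹' {x | BddAbove (Set.range fun n => birkhoffSum T f n x)} =
      {x | BddAbove (Set.range fun n => birkhoffSum T f n x)} :=
    Set.ext bddAbove_range_birkhoffSum_comp_iff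
  refine (hT.quasiErgodic.ae_mem_or_ae_notMem₀ hmeas hinv.eventuallyEq).resolve_right fun h => ?_
  exact hneg.not_ge (integral_nonneg_of_ae_not_bddAbove_birkhoffSum hT.toMeasurePreserving hf h)

variable [IsProbabilityMeasure μ]

theorem ae_eventually_birkhoffSum_le (hT : Ergodic T μ) (hf : Integrable f μ) {a : ℝ}
    (ha : ∫ x, f x ∂μ < a) : ∀ᵐ x ∂μ, ∀ᶠ n : ℕ in atTop, birkhoffSum T f n x ≤ n * a := by
  obtain ⟨b, hfb, hba⟩ := exists_between ha
  have hneg : ∫ x, (f - fun _ => b : X → ℝ) x ∂μ < 0 := by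
    rw [integral_sub' hf (integrable_const b)]
    simpa using hfb
  filter_upwards [ae_bddAbove_birkhoffSum hT (hf.sub (integrable_const b)) hneg] with x hx
  obtain ⟨K, hK⟩ := hx
  filter_upwards [tendsto_natCast_atTop_atTop.eventually_ge_atTop (K / (a - b))] with n hn
  have hsum : birkhoffSum T f n x - n * b ≤ K := by
    have := hK ⟨n, rfl⟩
    simpa [birkhoffSum_sub, birkhoffSum] using this
  rw [div_le_iff₀ (sub_pos.2 hba)] at hn
  linarith

theorem ae_tendsto_birkhoffSum_div (hT : Ergodic T μ) (hf : Integrable f μ) :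
    ∀ᵐ x ∂μ, Tendsto (fun n : ℕ => birkhoffSum T f n x / n) atTop (𝓝 (∫ y, f y ∂μ)) := by
  set I := ∫ y, f y ∂μ
  have hupper : ∀ᵐ x ∂μ, ∀ k : ℕ, ∀ᶠ n : ℕ in atTop,
      birkhoffSum T f n x ≤ n * (I + 1 / ((k : ℝ) + 1)) :=
    ae_all_iff.2 fun k => ae_eventually_birkhoffSum_le hT hf
      (lt_add_of_pos_right I Nat.one_div_pos_of_nat)
  have hlower : ∀ᵐ x ∂μ, ∀ k : ℕ, ∀ᶠ n : ℕ in atTop,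
      birkhoffSum T (-f) n x ≤ n * (-I + 1 / ((k : ℝ) + 1)) :=
    ae_all_iff.2 fun k => ae_eventually_birkhoffSum_le hT hf.neg (by
      rw [integral_neg']
      exact lt_add_of_pos_right (-I) Nat.one_div_pos_of_nat)
  filter_upwards [hupper, hlower] with x hx_upper hx_lower
  refine Metric.tendsto_nhds.2 fun ε hε => ?_
  obtain ⟨k, hk⟩ := exists_nat_one_div_lt hε
  filter_upwards [hx_upper k, hx_lower k, eventually_gt_atTop 0] with n hn_upper hn_lower hn
  have hn' : (0 : ℝ) < n := Nat.cast_pos.2 hn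
  rw [birkhoffSum_neg] at hn_lower
  rw [Real.dist_eq, abs_lt, lt_sub_iff_add_lt, sub_lt_iff_lt_add, lt_div_iff₀ hn',
    div_lt_iff₀ hn']
  constructor <;> nlinarith

end Birkhoff

section Recurrence

variable {X : Type*} [MeasurableSpace X] {μ : Measure X} {T : X → X}

theorem measureReal_preimage_iterate (hT : MeasurePreserving T μ μ) {A : Set X}
    (hA : MeasurableSet A) (n : ℕ) : μ.real (T^[n] ⁻¹' A) = μ.real A :=
  (hT.iterate n).measureReal_preimage hA.nullMeasurableSet

theorem sum_measureReal_le_add_sum_measureReal_inter [IsFiniteMeasure μ] {A : ℕ → Set X}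
    (hA : ∀ i, MeasurableSet (A i)) (n : ℕ) :
    ∑ i ∈ Finset.range n, μ.real (A i) ≤ μ.real (⋃ i ∈ Finset.range n, A i) +
      ∑ i ∈ Finset.range n, ∑ j ∈ Finset.range i, μ.real (A i ∩ A j) := by
  induction n with
  | zero => simp
  | succ n ih =>
    have hinter : μ.real (A n ∩ ⋃ j ∈ Finset.range n, A j) ≤
        ∑ j ∈ Finset.range n, μ.real (A n ∩ A j) := by
      simp only [Set.inter_iUnion₂]
      exact measureReal_biUnion_finset_le _ _
    have hunion := measureReal_union_add_inter' (μ := μ) (hA n) (t := ⋃ j ∈ Finset.range n, A j)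
      (measure_ne_top _ _) (measure_ne_top _ _)
    rw [Finset.sum_range_succ, Finset.sum_range_succ _ n, Finset.range_add_one,
      Finset.set_biUnion_insert]
    linarith

theorem exists_lt_le_measureReal_inter [IsProbabilityMeasure μ] {A : ℕ → Set X}
    (hA : ∀ i, MeasurableSet (A i)) {r : ℝ} (hr : ∀ i, r ≤ μ.real (A i)) {n : ℕ}
    (hn : 2 < n * r) : ∃ i, ∃ j < i, r / (2 * n) ≤ μ.real (A i ∩ A j) := by
  by_contra! hsmall
  have hn0 : (0 : ℝ) < n := by
    rcases n.eq_zero_or_pos with rfl | h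
    · norm_num at hn
    · exact_mod_cast h
  have hr0 : 0 < r := by
    by_contra! hr0
    nlinarith
  have hpairs : ∑ i ∈ Finset.range n, ∑ j ∈ Finset.range i, μ.real (A i ∩ A j) ≤ n * (r / 2) :=
    calc ∑ i ∈ Finset.range n, ∑ j ∈ Finset.range i, μ.real (A i ∩ A j)
      _ ≤ ∑ i ∈ Finset.range n, ∑ _j ∈ Finset.range n, r / (2 * n) := by
        refine Finset.sum_le_sum fun i hi => ?_
        refine (Finset.sum_le_sum fun j hj => (hsmall i j (Finset.mem_range.1 hj)).le).trans ?_
        exact Finset.sum_le_sum_of_subset_of_nonneg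
          (Finset.range_subset_range.2 (Finset.mem_range.1 hi).le) fun _ _ _ => by positivity
      _ = n * (r / 2) := by
        simp only [Finset.sum_const, Finset.card_range, nsmul_eq_mul]
        field_simp
  have hsum : n * r ≤ ∑ i ∈ Finset.range n, μ.real (A i) := by
    simpa using Finset.card_nsmul_le_sum (Finset.range n) (fun i => μ.real (A i)) r fun i _ => hr i
  have hone : μ.real (⋃ i ∈ Finset.range n, A i) ≤ 1 := measureReal_le_one
  linarith [sum_measureReal_le_add_sum_measureReal_inter (μ := μ) hA n]

theorem exists_le_measureReal_inter_preimage_iterate [IsProbabilityMeasure μ]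
    (hT : MeasurePreserving T μ μ) {B : Set X} (hB : MeasurableSet B) (hpos : μ B ≠ 0) :
    ∃ c : ℝ, 0 < c ∧ ∀ N : ℕ, ∃ v : ℕ, 0 < v ∧ c ≤ μ.real (B ∩ T^[N * v] ⁻¹' B) := by
  have hr : 0 < μ.real B := ENNReal.toReal_pos hpos (measure_ne_top μ B)
  obtain ⟨K, hK⟩ := exists_nat_gt (2 / μ.real B)
  have hK0 : (0 : ℝ) < K := lt_trans (by positivity) hK
  refine ⟨μ.real B / (2 * K), by positivity, fun N => ?_⟩
  have hmeas : ∀ i, MeasurableSet (T^[N * i] ⁻¹' B) := fun i => (hT.measurable.iterate _) hB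
  obtain ⟨i, j, hji, hij⟩ := exists_lt_le_measureReal_inter hmeas
    (fun i => (measureReal_preimage_iterate hT hB (N * i)).ge) ((div_lt_iff₀ hr).1 hK)
  have hshift : T^[N * i] ⁻¹' B ∩ T^[N * j] ⁻¹' B =
      T^[N * j] ⁻¹' (B ∩ T^[N * (i - j)] ⁻¹' B) := by
    rw [Set.preimage_inter, ← Set.preimage_comp, ← Function.iterate_add, ← mul_add,
      Nat.sub_add_cancel hji.le, Set.inter_comm]
  rw [hshift, measureReal_preimage_iterate hT (hB.inter (hmeas (i - j)))] at hij
  exact ⟨i - j, Nat.sub_pos_of_lt hji, hij⟩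

theorem ae_exists_iterate_mem [IsFiniteMeasure μ] (hT : Ergodic T μ) {E : Set X}
    (hE : MeasurableSet E) (hpos : μ E ≠ 0) : ∀ᵐ x ∂μ, ∃ t : ℕ, T^[t] x ∈ E := by
  have hmeas : MeasurableSet {x | ∃ t : ℕ, T^[t] x ∈ E} := by
    rw [Set.ofPred_exists]
    exact .iUnion fun t => (hT.measurable.iterate t) hE
  have hsub : T ⁻¹' {x | ∃ t : ℕ, T^[t] x ∈ E} ⊆ {x | ∃ t : ℕ, T^[t] x ∈ E} :=
    fun x ⟨t, ht⟩ => ⟨t + 1, ht⟩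
  refine eventuallyEq_univ.1 ((hT.ae_empty_or_univ_of_preimage_ae_le hmeas.nullMeasurableSet
    hsub.eventuallyLE).resolve_left fun hempty => hpos ?_)
  exact measure_mono_null (fun x hx => Set.mem_ofPred.2 ⟨0, hx⟩) (ae_eq_empty.1 hempty)

end Recurrence

section Towers

variable {X : Type*} {T : X → X}

/-- The points whose first `n` iterates, starting with the point itself, avoid `E`. -/
def avoidSet (T : X → X) (E : Set X) (n : ℕ) : Set X := {x | ∀ k < n, T^[k] x ∉ E}

/-- The points that enter `E` for the first time at time `t`. -/
def firstHit (T : X → X) (E : Set X) (t : ℕ) : Set X := T^[t] ⁻¹' E ∩ avoidSet T E t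

/-- `Q` is the base of a tower of height `H`: the levels `T^[k] '' Q`, `k < H`, are disjoint
from `Q`, and hence from each other when `T` is injective. -/
def IsTowerBase (T : X → X) (H : ℕ) (Q : Set X) : Prop :=
  ∀ x ∈ Q, ∀ k, 0 < k → k < H → T^[k] x ∉ Q

theorem avoidSet_antitone (E : Set X) : Antitone (avoidSet T E) :=
  fun _ _ hnm _ hx k hk => hx k (hk.trans_le hnm)

theorem avoidSet_eq_biInter (E : Set X) (n : ℕ) :
    avoidSet T E n = ⋂ k ∈ Finset.range n, (T^[k] ⁻¹' E)ᶜ := by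
  ext x
  simp [avoidSet]

theorem isClopen_avoidSet [TopologicalSpace X] (hT : Continuous T) {E : Set X}
    (hE : IsClopen E) (n : ℕ) : IsClopen (avoidSet T E n) := by
  rw [avoidSet_eq_biInter]
  exact isClopen_biInter_finset fun k _ => (hE.preimage (hT.iterate k)).compl

theorem isClopen_firstHit [TopologicalSpace X] (hT : Continuous T) {E : Set X}
    (hE : IsClopen E) (t : ℕ) : IsClopen (firstHit T E t) :=
  (hE.preimage (hT.iterate t)).inter (isClopen_avoidSet hT hE t)

theorem firstHit_unique {E : Set X} {x : X} {s t : ℕ} (hs : x ∈ firstHit T E s)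
    (ht : x ∈ firstHit T E t) : s = t := by
  rcases lt_trichotomy s t with hlt | heq | hlt
  · exact absurd hs.1 (ht.2 s hlt)
  · exact heq
  · exact absurd ht.1 (hs.2 t hlt)

theorem iterate_mem_firstHit {E : Set X} {x : X} {k t : ℕ} (hx : x ∈ firstHit T E (t + k)) :
    T^[k] x ∈ firstHit T E t := by
  refine ⟨?_, fun j hj => ?_⟩
  · simpa only [Set.mem_preimage, Function.iterate_add_apply] using hx.1
  · rw [← Function.iterate_add_apply]
    exact hx.2 _ (Nat.add_lt_add_right hj k)

theorem exists_mem_firstHit {E : Set X} {x : X} {n : ℕ} (hx : x ∉ avoidSet T E n) :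
    ∃ t < n, x ∈ firstHit T E t := by
  classical
  have hex : ∃ t, t < n ∧ T^[t] x ∈ E := by simpa [avoidSet] using hx
  obtain ⟨hlt, hmem⟩ := Nat.find_spec hex
  exact ⟨Nat.find hex, hlt, hmem, fun k hk hkE => Nat.find_min hex hk ⟨hk.trans hlt, hkE⟩⟩

-- The hitting time drops by one at each step, so residues modulo `H` recur only after time `H`.
theorem isTowerBase_iUnion_firstHit {E : Set X} {H r : ℕ} {I : Finset ℕ}
    (hI : ∀ t ∈ I, H ≤ t ∧ t ≡ r [MOD H]) : IsTowerBase T H (⋃ t ∈ I, firstHit T E t) := by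
  intro x hx k hk hkH hkx
  simp only [Set.mem_iUnion, exists_prop] at hx hkx
  obtain ⟨t, ht, hxt⟩ := hx
  obtain ⟨s, hs, hxs⟩ := hkx
  obtain ⟨hHt, htr⟩ := hI t ht
  obtain ⟨d, rfl⟩ := Nat.exists_eq_add_of_le' (hkH.le.trans hHt)
  obtain rfl := firstHit_unique (iterate_mem_firstHit hxt) hxs
  have hmod : k ≡ 0 [MOD H] := (htr.trans (hI d hs).2.symm).add_left_cancel' d
  exact hk.ne' (Nat.ModEq.eq_of_lt_of_lt hmod hkH (hk.trans hkH))

variable [MeasurableSpace X] {μ : Measure X}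

theorem measurableSet_avoidSet (hT : Measurable T) {E : Set X} (hE : MeasurableSet E) (n : ℕ) :
    MeasurableSet (avoidSet T E n) := by
  rw [avoidSet_eq_biInter]
  exact Finset.measurableSet_biInter _ fun k _ => (hT.iterate k hE).compl

theorem tendsto_measureReal_avoidSet [IsFiniteMeasure μ] (hT : Ergodic T μ) {E : Set X}
    (hE : MeasurableSet E) (hpos : μ E ≠ 0) :
    Tendsto (fun n => μ.real (avoidSet T E n)) atTop (𝓝 0) := by
  have hlim := tendsto_measure_iInter_atTop (μ := μ)
    (fun n => (measurableSet_avoidSet hT.measurable hE n).nullMeasurableSet)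
    (avoidSet_antitone E) ⟨0, measure_ne_top _ _⟩
  have hnull : μ (⋂ n, avoidSet T E n) = 0 := by
    refine measure_mono_null (fun x hx => ?_) (ae_iff.1 (ae_exists_iterate_mem hT hE hpos))
    rintro ⟨t, ht⟩
    exact Set.mem_iInter.1 hx (t + 1) t t.lt_succ_self ht
  rw [hnull] at hlim
  exact (ENNReal.tendsto_toReal ENNReal.zero_ne_top).comp hlim

theorem measureReal_le_sum_measureReal_firstHit [IsFiniteMeasure μ] (hT : MeasurePreserving T μ μ)
    {E : Set X} (hE : MeasurableSet E) (C : Set X) {H : ℕ} (hH : 0 < H) (N : ℕ) :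
    μ.real C ≤
      ∑ r ∈ Finset.range H, μ.real
        (C ∩ ⋃ t ∈ {t ∈ Finset.range N | H ≤ t ∧ t % H = r}, firstHit T E t) +
      H * μ.real E + μ.real (avoidSet T E N) := by
  have hcover : C ⊆
      (⋃ r ∈ Finset.range H,
        C ∩ ⋃ t ∈ {t ∈ Finset.range N | H ≤ t ∧ t % H = r}, firstHit T E t) ∪
      (⋃ t ∈ Finset.range H, T^[t] ⁻¹' E) ∪ avoidSet T E N := by
    intro x hx
    by_cases havoid : x ∈ avoidSet T E N
    · exact Or.inr havoid
    obtain ⟨t, htN, ht⟩ := exists_mem_firstHit havoid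
    simp only [Set.mem_union, Set.mem_iUnion, Set.mem_inter_iff, Finset.mem_filter,
      Finset.mem_range, exists_prop]
    rcases lt_or_ge t H with htH | htH
    · exact Or.inl (Or.inr ⟨t, htH, ht.1⟩)
    · exact Or.inl (Or.inl ⟨t % H, Nat.mod_lt t hH, hx, t, ⟨htN, htH, rfl⟩, ht⟩)
  refine (measureReal_mono hcover).trans ((measureReal_union_le _ _).trans ?_)
  gcongr
  refine (measureReal_union_le _ _).trans (add_le_add (measureReal_biUnion_finset_le _ _) ?_)
  refine (measureReal_biUnion_finset_le _ _).trans ?_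
  simp [measureReal_preimage_iterate hT hE]

-- A topological Rokhlin lemma: split `C` according to the residue modulo `H` of the hitting time
-- of the small set `E`.
theorem exists_isClopen_isTowerBase [TopologicalSpace X] [OpensMeasurableSpace X]
    [IsFiniteMeasure μ] (hT : Ergodic T μ) (hTc : Continuous T) {C E : Set X} (hC : IsClopen C)
    (hE : IsClopen E) (hpos : μ E ≠ 0) {H : ℕ} (hH : 0 < H)
    (hEC : 4 * H * μ.real E ≤ μ.real C) :
    ∃ Q ⊆ C, IsClopen Q ∧ IsTowerBase T H Q ∧ μ.real C ≤ 2 * H * μ.real Q := by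
  have hE0 : 0 < μ.real E := ENNReal.toReal_pos hpos (measure_ne_top μ E)
  have hC0 : 0 < μ.real C := lt_of_lt_of_le (by positivity) hEC
  obtain ⟨N, hN⟩ := ((tendsto_measureReal_avoidSet hT hE.isOpen.measurableSet
    hpos).eventually_le_const (by positivity : 0 < μ.real C / 4)).exists
  set I : ℕ → Finset ℕ := fun r => {t ∈ Finset.range N | H ≤ t ∧ t % H = r}
  obtain ⟨r, hr, hQ⟩ : ∃ r ∈ Finset.range H,
      μ.real C / (2 * H) ≤ μ.real (C ∩ ⋃ t ∈ I r, firstHit T E t) := by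
    refine Finset.exists_le_of_sum_le (Finset.nonempty_range_iff.2 hH.ne') ?_
    have hconst : ∑ _r ∈ Finset.range H, μ.real C / (2 * H) = μ.real C / 2 := by
      rw [Finset.sum_const, Finset.card_range, nsmul_eq_mul]
      field_simp
    have hsplit := measureReal_le_sum_measureReal_firstHit hT.toMeasurePreserving
      hE.isOpen.measurableSet C hH N
    linarith
  refine ⟨C ∩ ⋃ t ∈ I r, firstHit T E t, Set.inter_subset_left,
    hC.inter (isClopen_biUnion_finset fun t _ => isClopen_firstHit hTc hE t), ?_, ?_⟩
  · have hbase := isTowerBase_iUnion_firstHit (T := T) (E := E) (I := I r) (H := H) (r := r)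
      fun t ht => by
        obtain ⟨-, hHt, hmod⟩ := Finset.mem_filter.1 ht
        exact ⟨hHt, by rw [Nat.ModEq, hmod, Nat.mod_eq_of_lt (Finset.mem_range.1 hr)]⟩
    exact fun x hx k hk hkH hkx => hbase x hx.2 k hk hkH hkx.2
  · rw [div_le_iff₀ (by positivity)] at hQ
    linarith

theorem exists_isTowerBase_subset_avoidSet [TopologicalSpace X] [OpensMeasurableSpace X]
    [IsProbabilityMeasure μ] (hT : Ergodic T μ) (hTc : Continuous T) {A : Set X}
    (hA : IsClopen A) (hpos : μ A ≠ 0) (havoid : ∀ L, μ (avoidSet T A L) ≠ 0) (L q : ℕ) {K : ℕ}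
    (hK : 0 < K) :
    ∃ c : ℝ, 0 < c ∧ ∀ N : ℕ, ∃ v, N ≤ v ∧
      ∃ Q ⊆ avoidSet T A L ∩ T^[q * v] ⁻¹' avoidSet T A L,
        IsClopen Q ∧ IsTowerBase T (K * v) Q ∧ c ≤ v * μ.real Q := by
  have hZ := isClopen_avoidSet hTc hA L
  obtain ⟨c, hc, hrec⟩ := exists_le_measureReal_inter_preimage_iterate hT.toMeasurePreserving
    hZ.isOpen.measurableSet (havoid L)
  refine ⟨c / (2 * K), by positivity, fun N => ?_⟩
  obtain ⟨w, hw, hcw⟩ := hrec (q * (N + 1))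
  obtain ⟨v, hv⟩ : ∃ v, v = (N + 1) * w := ⟨_, rfl⟩
  have hv0 : 0 < v := hv ▸ Nat.mul_pos N.succ_pos hw
  have hNv : N ≤ v := hv ▸ N.le_succ.trans (Nat.le_mul_of_pos_right _ hw)
  rw [mul_assoc, ← hv] at hcw
  obtain ⟨M, hM⟩ := ((tendsto_measureReal_avoidSet hT hA.isOpen.measurableSet
    hpos).eventually_le_const (by positivity : 0 < c / (4 * (K * v : ℕ)))).exists
  rw [le_div_iff₀ (by positivity)] at hM
  obtain ⟨Q, hQsub, hQ, hbase, hle⟩ := exists_isClopen_isTowerBase hT hTc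
    (hZ.inter (hZ.preimage (hTc.iterate (q * v)))) (isClopen_avoidSet hTc hA M) (havoid M)
    (Nat.mul_pos hK hv0) (by linarith)
  refine ⟨v, hNv, Q, hQsub, hQ, hbase, ?_⟩
  rw [div_le_iff₀ (by positivity)]
  push_cast at hle
  linarith

end Towers

section Phase

variable {X : Type*} [TopologicalSpace X] {T : X → X} {A : Set X} {Φ ψ ψ' : X → ℝ}

/-- A continuous angle which, on `A`, takes values in the multiples of `π / 2` and does not change
when `T` is applied. Rotating by such an angle conjugates a cocycle equal to a fixed diagonal
matrix on `A` and to the identity off `A` to a diagonal one. -/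
structure IsPhase (T : X → X) (A : Set X) (ψ : X → ℝ) : Prop where
  continuous : Continuous ψ
  sin_two_mul_eq_zero : ∀ x ∈ A, Real.sin (2 * ψ x) = 0
  map_eq : ∀ x ∈ A, ψ (T x) = ψ x

theorem IsPhase.zero : IsPhase T A 0 :=
  ⟨continuous_zero, fun _ _ => by simp, fun _ _ => rfl⟩

theorem IsPhase.add (h : IsPhase T A ψ) (h' : IsPhase T A ψ') : IsPhase T A (ψ + ψ') where
  continuous := h.continuous.add h'.continuous
  sin_two_mul_eq_zero x hx := by
    rw [Pi.add_apply, mul_add, Real.sin_add, h.sin_two_mul_eq_zero x hx,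
      h'.sin_two_mul_eq_zero x hx, zero_mul, mul_zero, add_zero]
  map_eq x hx := by rw [Pi.add_apply, Pi.add_apply, h.map_eq x hx, h'.map_eq x hx]

theorem IsPhase.sum {ι : Type*} {ψ : ι → X → ℝ} (h : ∀ i, IsPhase T A (ψ i)) (s : Finset ι) :
    IsPhase T A (∑ i ∈ s, ψ i) :=
  Finset.sum_induction _ _ (fun _ _ => IsPhase.add) IsPhase.zero fun i _ => h i

/-- The logarithmic growth rate of the cocycle with angle `Φ`: it is `1` on the part of `A` where
`Φ` is an even multiple of `π / 2`, `-1` where it is an odd multiple, and `0` off `A`. -/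
noncomputable def phasePotential {X : Type*} (A : Set X) (Φ : X → ℝ) : X → ℝ :=
  A.indicator fun x => Real.cos (2 * Φ x)

theorem abs_phasePotential_le {X : Type*} (A : Set X) (Φ : X → ℝ) (x : X) :
    |phasePotential A Φ x| ≤ 1 := by
  rw [phasePotential]
  by_cases hx : x ∈ A
  · rw [Set.indicator_of_mem hx]
    exact Real.abs_cos_le_one _
  · simp [Set.indicator_of_notMem hx]

theorem phasePotential_congr {X : Type*} (A : Set X) {Φ Ψ : X → ℝ} {x : X} (h : Φ x = Ψ x) :
    phasePotential A Φ x = phasePotential A Ψ x := by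
  simp only [phasePotential, Set.indicator, h]

section Measurable

variable {X : Type*} [MeasurableSpace X] {A : Set X} {Φ : X → ℝ}

theorem measurable_phasePotential (hA : MeasurableSet A) (hΦ : Measurable Φ) :
    Measurable (phasePotential A Φ) :=
  (Real.measurable_cos.comp (hΦ.const_mul 2)).indicator hA

theorem integrable_phasePotential {μ : Measure X} [IsFiniteMeasure μ] (hA : MeasurableSet A)
    (hΦ : Measurable Φ) : Integrable (phasePotential A Φ) μ :=
  .of_bound (measurable_phasePotential hA hΦ).aestronglyMeasurable 1
    (ae_of_all _ (abs_phasePotential_le A Φ))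

end Measurable

end Phase

section Bump

/-- The profile on `ℕ` that rises linearly from `0` to `π / 2` on `[0, L]`, stays there on
`[L, n]`, and returns linearly to `0` on `[n, n + L]`. -/
noncomputable def trapezoid (L n j : ℕ) : ℝ := Real.pi / 2 / L * (min (min j L) (n + L - j) : ℕ)

theorem trapezoid_zero (L n : ℕ) : trapezoid L n 0 = 0 := by simp [trapezoid]

theorem trapezoid_of_le {L n j : ℕ} (h : n + L ≤ j) : trapezoid L n j = 0 := by
  simp [trapezoid, Nat.sub_eq_zero_of_le h]

theorem trapezoid_of_mem_Icc {L n j : ℕ} (hL : 0 < L) (hj : j ∈ Set.Icc L n) :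
    trapezoid L n j = Real.pi / 2 := by
  have hmin : min (min j L) (n + L - j) = L := by grind
  rw [trapezoid, hmin, div_mul_cancel₀ _ (Nat.cast_ne_zero.2 hL.ne')]

theorem abs_trapezoid_succ_sub_le (L n j : ℕ) :
    |trapezoid L n (j + 1) - trapezoid L n j| ≤ Real.pi / 2 / L := by
  have hslope : 0 ≤ Real.pi / 2 / L := by positivity
  rw [trapezoid, trapezoid, ← mul_sub, abs_mul, abs_of_nonneg hslope]
  refine mul_le_of_le_one_right hslope ?_
  have hstep : |((min (min (j + 1) L) (n + L - (j + 1)) : ℕ) : ℤ) -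
      (min (min j L) (n + L - j) : ℕ)| ≤ 1 := by grind
  exact_mod_cast hstep

variable {X : Type*} [TopologicalSpace X] {T : X ≃ₜ X} {A Q : Set X} {H L n : ℕ}

/-- The angle that follows the profile `trapezoid L n` up the tower over `Q`: its value at a point
`x` of the level `T^[j] '' Q` is `trapezoid L n j`. -/
noncomputable def bump (T : X ≃ₜ X) (Q : Set X) (L n : ℕ) (x : X) : ℝ :=
  ∑ j ∈ Finset.range (n + L), trapezoid L n j * Q.indicator 1 (T.symm^[j] x)

theorem continuous_bump (hQ : IsClopen Q) : Continuous (bump T Q L n) :=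
  continuous_finsetSum _ fun j _ => continuous_const.mul
    ((hQ.continuous_indicator continuous_one).comp (T.symm.continuous.iterate j))

theorem bump_eq_zero {x : X} (hx : ∀ j < n + L, T.symm^[j] x ∉ Q) : bump T Q L n x = 0 :=
  Finset.sum_eq_zero fun j hj => by
    rw [Set.indicator_of_notMem (hx j (Finset.mem_range.1 hj)), mul_zero]

theorem symm_iterate_iterate (T : X ≃ₜ X) (j : ℕ) (x : X) : T.symm^[j] (T^[j] x) = x :=
  Function.LeftInverse.iterate T.symm_apply_apply j x

theorem iterate_symm_iterate (T : X ≃ₜ X) (j : ℕ) (x : X) : T^[j] (T.symm^[j] x) = x :=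
  symm_iterate_iterate T.symm j x

theorem IsTowerBase.eq_of_symm_iterate_mem (hQ : IsTowerBase T H Q) {x : X} {i j : ℕ}
    (hi : i < H) (hj : j < H) (hxi : T.symm^[i] x ∈ Q) (hxj : T.symm^[j] x ∈ Q) : i = j := by
  wlog hij : i < j generalizing i j with hwlog
  · rcases eq_or_lt_of_le (not_lt.1 hij) with heq | hlt
    · exact heq.symm
    · exact (hwlog hj hi hxj hxi hlt).symm
  refine absurd hxi ?_
  obtain ⟨d, rfl⟩ := Nat.exists_eq_add_of_lt hij
  have hmove : T.symm^[i] x = T^[d + 1] (T.symm^[i + d + 1] x) := by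
    rw [add_assoc, add_comm i, Function.iterate_add_apply T.symm, iterate_symm_iterate]
  rw [hmove]
  exact hQ _ hxj _ d.succ_pos (by omega)

theorem bump_iterate (hQ : IsTowerBase T H Q) (hH : n + L ≤ H) {y : X} (hy : y ∈ Q) {j : ℕ}
    (hj : j < H) : bump T Q L n (T^[j] y) = trapezoid L n j := by
  have hyj : T.symm^[j] (T^[j] y) ∈ Q := by rwa [symm_iterate_iterate]
  have hother : ∀ i < n + L, i ≠ j → T.symm^[i] (T^[j] y) ∉ Q := fun i hi hij hmem =>
    hij (hQ.eq_of_symm_iterate_mem (hi.trans_le hH) hj hmem hyj)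
  rcases lt_or_ge j (n + L) with hlt | hge
  · rw [bump, Finset.sum_eq_single_of_mem j (Finset.mem_range.2 hlt),
      Set.indicator_of_mem hyj, Pi.one_apply, mul_one]
    intro i hi hij
    rw [Set.indicator_of_notMem (hother i (Finset.mem_range.1 hi) hij), mul_zero]
  · rw [trapezoid_of_le hge]
    exact bump_eq_zero fun i hi => hother i hi (hi.trans_le hge).ne

theorem bump_eq_zero_or_exists_iterate (hQ : IsTowerBase T H Q) (hH : n + L < H) (x : X) :
    (bump T Q L n x = 0 ∧ bump T Q L n (T x) = 0) ∨
      ∃ y ∈ Q, ∃ j < n + L, T^[j] y = x ∧ bump T Q L n x = trapezoid L n j ∧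
        bump T Q L n (T x) = trapezoid L n (j + 1) := by
  by_cases hx : ∃ j < n + L, T.symm^[j] x ∈ Q
  · obtain ⟨j, hj, hy⟩ := hx
    have hbump := bump_iterate (n := n) (L := L) hQ hH.le hy (j := j) (by omega)
    have hbump_succ := bump_iterate (n := n) (L := L) hQ hH.le hy (j := j + 1) (by omega)
    rw [Function.iterate_succ_apply', iterate_symm_iterate] at hbump_succ
    rw [iterate_symm_iterate] at hbump
    exact Or.inr ⟨_, hy, j, hj, iterate_symm_iterate T j x, hbump, hbump_succ⟩
  · push Not at hx
    refine Or.inl ⟨bump_eq_zero hx, ?_⟩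
    by_cases hTx : T x ∈ Q
    · exact (bump_iterate hQ hH.le hTx (j := 0) (by omega)).trans (trapezoid_zero L n)
    · refine bump_eq_zero fun j hj => ?_
      cases j with
      | zero => exact hTx
      | succ j =>
        rw [Function.iterate_succ_apply, T.symm_apply_apply]
        exact hx j (by omega)

theorem abs_bump_map_sub_le (hQ : IsTowerBase T H Q) (hH : n + L < H) (x : X) :
    |bump T Q L n (T x) - bump T Q L n x| ≤ Real.pi / 2 / L := by
  rcases bump_eq_zero_or_exists_iterate hQ hH x with ⟨hx, hTx⟩ | ⟨y, -, j, -, -, hx, hTx⟩ <;>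
    rw [hx, hTx]
  · rw [sub_zero, abs_zero]
    positivity
  · exact abs_trapezoid_succ_sub_le L n j

theorem le_and_notMem_Ico_of_iterate_mem
    (hQA : Q ⊆ avoidSet T A L ∩ T^[n] ⁻¹' avoidSet T A L) {y : X} (hy : y ∈ Q) {j : ℕ}
    (hj : T^[j] y ∈ A) : L ≤ j ∧ j ∉ Set.Ico n (n + L) := by
  obtain ⟨hstart, hend⟩ := hQA hy
  refine ⟨not_lt.1 fun hlt => hstart j hlt hj, fun ⟨hnj, hjL⟩ => hend (j - n) (by omega) ?_⟩
  rwa [← Function.iterate_add_apply, Nat.sub_add_cancel hnj]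

theorem isPhase_bump (hQc : IsClopen Q) (hQ : IsTowerBase T H Q)
    (hQA : Q ⊆ avoidSet T A L ∩ T^[n] ⁻¹' avoidSet T A L) (hL : 0 < L) (hH : n + L < H) :
    IsPhase T A (bump T Q L n) := by
  have hvalue : ∀ x ∈ A, bump T Q L n (T x) = bump T Q L n x ∧
      (bump T Q L n x = 0 ∨ bump T Q L n x = Real.pi / 2) := by
    intro x hxA
    rcases bump_eq_zero_or_exists_iterate hQ hH x with ⟨hx, hTx⟩ | ⟨y, hy, j, hj, rfl, hx, hTx⟩
    · exact ⟨hTx.trans hx.symm, Or.inl hx⟩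
    · obtain ⟨hLj, hnj⟩ := le_and_notMem_Ico_of_iterate_mem hQA hy hxA
      have hjn : j < n := not_le.1 fun hle => hnj ⟨hle, hj⟩
      rw [hx, hTx, trapezoid_of_mem_Icc hL ⟨hLj, hjn.le⟩,
        trapezoid_of_mem_Icc hL ⟨hLj.trans j.le_succ, hjn⟩]
      exact ⟨rfl, Or.inr rfl⟩
  refine ⟨continuous_bump hQc, fun x hx => ?_, fun x hx => (hvalue x hx).1⟩
  rcases (hvalue x hx).2 with h | h
  · rw [h, mul_zero, Real.sin_zero]
  · rw [h, mul_div_cancel₀ _ (two_ne_zero' ℝ), Real.sin_pi]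

theorem phasePotential_add_bump_iterate (hQ : IsTowerBase T H Q)
    (hQA : Q ⊆ avoidSet T A L ∩ T^[n] ⁻¹' avoidSet T A L) (hL : 0 < L) (hH : n + L ≤ H)
    (Φ : X → ℝ) {y : X} (hy : y ∈ Q) {j : ℕ} (hj : j < H) :
    phasePotential A (Φ + bump T Q L n) (T^[j] y) =
      if j < n then -phasePotential A Φ (T^[j] y) else phasePotential A Φ (T^[j] y) := by
  by_cases hA : T^[j] y ∈ A
  · obtain ⟨hLj, hnj⟩ := le_and_notMem_Ico_of_iterate_mem hQA hy hA
    rw [phasePotential, phasePotential, Set.indicator_of_mem hA, Set.indicator_of_mem hA,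
      Pi.add_apply, bump_iterate hQ hH hy hj]
    split_ifs with hjn
    · rw [trapezoid_of_mem_Icc hL ⟨hLj, hjn.le⟩, mul_add, mul_div_cancel₀ _ (two_ne_zero' ℝ),
        Real.cos_add_pi]
    · rw [trapezoid_of_le (not_lt.1 fun hlt => hnj ⟨not_lt.1 hjn, hlt⟩), add_zero]
  · simp [phasePotential, Set.indicator_of_notMem hA]

theorem birkhoffSum_phasePotential_add_bump (hQ : IsTowerBase T H Q)
    (hQA : Q ⊆ avoidSet T A L ∩ T^[n] ⁻¹' avoidSet T A L) (hL : 0 < L) (hnL : n + L ≤ H)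
    (hH : 2 * n ≤ H) (Φ : X → ℝ) {y : X} (hy : y ∈ Q) {i : ℕ} (hi : i ≤ n) :
    birkhoffSum T (phasePotential A (Φ + bump T Q L n)) n (T^[i] y) =
      birkhoffSum T (phasePotential A Φ) n (T^[i] y) -
        2 * birkhoffSum T (phasePotential A Φ) (n - i) (T^[i] y) := by
  obtain ⟨m, rfl⟩ := Nat.exists_eq_add_of_le' hi
  have hterm : ∀ t < m + i, phasePotential A (Φ + bump T Q L (m + i)) (T^[t] (T^[i] y)) =
      if t < m then -phasePotential A Φ (T^[t] (T^[i] y))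
      else phasePotential A Φ (T^[t] (T^[i] y)) := by
    intro t ht
    simp only [← Function.iterate_add_apply]
    rw [phasePotential_add_bump_iterate hQ hQA hL hnL Φ hy (by omega)]
    simp only [Nat.add_lt_add_iff_right]
  have hfirst : birkhoffSum T (phasePotential A (Φ + bump T Q L (m + i))) m (T^[i] y) =
      -birkhoffSum T (phasePotential A Φ) m (T^[i] y) := by
    rw [birkhoffSum, birkhoffSum, ← Finset.sum_neg_distrib]
    refine Finset.sum_congr rfl fun t ht => ?_
    rw [hterm t (by grind), if_pos (Finset.mem_range.1 ht)]
  have hlast : birkhoffSum T (phasePotential A (Φ + bump T Q L (m + i))) i (T^[m] (T^[i] y)) =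
      birkhoffSum T (phasePotential A Φ) i (T^[m] (T^[i] y)) := by
    refine Finset.sum_congr rfl fun t ht => ?_
    rw [← Function.iterate_add_apply T t m, hterm (t + m) (by grind), if_neg (by omega)]
  rw [birkhoffSum_add, birkhoffSum_add, hfirst, hlast, Nat.add_sub_cancel]
  ring

variable [MeasurableSpace X] [OpensMeasurableSpace X] {μ : Measure X}

theorem measureReal_preimage_symm_iterate (hT : MeasurePreserving T μ μ) (hQ : IsClopen Q)
    (j : ℕ) : μ.real (T.symm^[j] ⁻¹' Q) = μ.real Q := by
  rw [← measureReal_preimage_iterate hT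
    (hQ.preimage (T.symm.continuous.iterate j)).isOpen.measurableSet j, ← Set.preimage_comp,
    (Function.LeftInverse.iterate T.symm_apply_apply j).comp_eq_id, Set.preimage_id]

variable [IsFiniteMeasure μ]

theorem IsTowerBase.measureReal_biUnion_levels (hQ : IsTowerBase T H Q)
    (hT : MeasurePreserving T μ μ) (hQc : IsClopen Q) {s : Finset ℕ} (hs : ∀ i ∈ s, i < H) :
    μ.real (⋃ i ∈ s, T.symm^[i] ⁻¹' Q) = s.card * μ.real Q := by
  rw [measureReal_biUnion_finset]
  · simp [measureReal_preimage_symm_iterate hT hQc]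
  · exact fun i hi j hj hij => Set.disjoint_left.2 fun x hxi hxj =>
      hij (hQ.eq_of_symm_iterate_mem (hs i hi) (hs j hj) hxi hxj)
  · exact fun i _ => (hQc.preimage (T.symm.continuous.iterate i)).isOpen.measurableSet

theorem measureReal_support_bump_le (hT : MeasurePreserving T μ μ) (hQ : IsClopen Q)
    (L n : ℕ) : μ.real (Function.support (bump T Q L n)) ≤ (n + L) * μ.real Q := by
  have hsub : Function.support (bump T Q L n) ⊆
      ⋃ j ∈ Finset.range (n + L), T.symm^[j] ⁻¹' Q := by
    intro x hx
    by_contra hmem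
    exact hx (bump_eq_zero (by simpa using hmem))
  refine (measureReal_mono hsub (measure_ne_top _ _)).trans
    ((measureReal_biUnion_finset_le _ _).trans ?_)
  simp [measureReal_preimage_symm_iterate hT hQ]

end Bump

section Perturbation

theorem exists_forall_notMem_abs_birkhoffSum_sub_le {X : Type*} [MeasurableSpace X]
    {μ : Measure X} [IsProbabilityMeasure μ] {T : X → X} (hT : Ergodic T μ) {f : X → ℝ}
    (hf : Measurable f) (hfi : Integrable f μ) {ε η : ℝ} (hε : 0 < ε) (hη : 0 < η) :
    ∃ D, μ.real D ≤ η ∧ ∃ N : ℕ, ∀ n ≥ N, ∀ x ∉ D,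
      |birkhoffSum T f n x - n * ∫ y, f y ∂μ| ≤ n * ε := by
  have hmeas : ∀ n : ℕ, StronglyMeasurable fun x => birkhoffSum T f n x / n := fun n =>
    ((Finset.measurable_sum _ fun k _ => hf.comp (hT.measurable.iterate k)).div_const
      _).stronglyMeasurable
  obtain ⟨D, -, hDη, hunif⟩ := tendstoUniformlyOn_of_ae_tendsto' hmeas stronglyMeasurable_const
    (ae_tendsto_birkhoffSum_div hT hfi) hη
  obtain ⟨N, hN⟩ := eventually_atTop.1 (Metric.tendstoUniformlyOn_iff.1 hunif ε hε)
  refine ⟨D, ENNReal.toReal_le_of_le_ofReal hη.le hDη, N + 1, fun n hn x hx => ?_⟩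
  have hn0 : (0 : ℝ) < n := by exact_mod_cast N.succ_pos.trans_le hn
  have hdist := (hN n (N.le_succ.trans hn) x hx).le
  rw [dist_comm, Real.dist_eq, div_sub' hn0.ne', abs_div, abs_of_pos hn0, div_le_iff₀ hn0]
    at hdist
  linarith

theorem abs_integral_phasePotential_le {X : Type*} [MeasurableSpace X] {μ : Measure X}
    [IsProbabilityMeasure μ] (A : Set X) (Φ : X → ℝ) : |∫ x, phasePotential A Φ x ∂μ| ≤ 1 := by
  simpa using norm_integral_le_of_norm_le_const (μ := μ) (f := phasePotential A Φ) (C := 1)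
    (ae_of_all _ (abs_phasePotential_le A Φ))

theorem abs_sub_two_mul_le {S S' n m lam ε : ℝ} (hS : |S - n * lam| ≤ n * ε)
    (hS' : |S' - m * lam| ≤ m * ε) (hlam : |lam| ≤ 1) (hε : 0 ≤ ε) (hmn : 2 * m ≤ n)
    (hnm : n - 2 * m ≤ n * ε) : |S - 2 * S'| ≤ n * (3 * ε) := by
  have hdrift : |(n - 2 * m) * lam| ≤ n - 2 * m := by
    rw [abs_mul, abs_of_nonneg (sub_nonneg.2 hmn)]
    exact mul_le_of_le_one_right (sub_nonneg.2 hmn) hlam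
  calc |S - 2 * S'|
    _ = |(S - n * lam) - 2 * (S' - m * lam) + (n - 2 * m) * lam| := by ring_nf
    _ ≤ |S - n * lam| + 2 * |S' - m * lam| + |(n - 2 * m) * lam| := by
      refine (abs_add_le _ _).trans (add_le_add_left ((abs_sub _ _).trans_eq ?_) _)
      rw [abs_mul, abs_two]
    _ ≤ n * (3 * ε) := by linarith [mul_le_mul_of_nonneg_right hmn hε]

variable {X : Type*} [TopologicalSpace X] [MeasurableSpace X] [OpensMeasurableSpace X]
  {μ : Measure X} {T : X ≃ₜ X} {A Q : Set X} {H L n : ℕ}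

theorem le_measureReal_abs_birkhoffSum_add_bump_le [IsFiniteMeasure μ]
    (hT : MeasurePreserving T μ μ) (hQc : IsClopen Q) (hQ : IsTowerBase T H Q)
    (hQA : Q ⊆ avoidSet T A L ∩ T^[n] ⁻¹' avoidSet T A L) (hL : 0 < L) (hnL : n + L ≤ H)
    (hH : 2 * n ≤ H) {Φ : X → ℝ} {D : Set X} {lam ε : ℝ} {N s v : ℕ}
    (hD : ∀ k ≥ N, ∀ x ∉ D, |birkhoffSum T (phasePotential A Φ) k x - k * lam| ≤ k * ε)
    (hlam : |lam| ≤ 1) (hε : 0 ≤ ε) (hs : 2 ≤ s) (hsε : 1 ≤ s * ε) (hNv : N ≤ v)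
    (hn : n = 2 * s * v) :
    v * μ.real Q ≤
      μ.real {x | |birkhoffSum T (phasePotential A (Φ + bump T Q L n)) n x| ≤ n * (3 * ε)} +
        μ.real D := by
  have hsv : 2 * v ≤ s * v := Nat.mul_le_mul_right v hs
  have hvn : 2 * (v : ℝ) ≤ n * ε := by
    rw [hn]
    push_cast
    linarith [mul_le_mul_of_nonneg_right hsε (Nat.cast_nonneg (α := ℝ) v)]
  have hsub : ⋃ i ∈ Finset.Ico (s * v) (s * v + v), T.symm^[i] ⁻¹' Q ⊆
      {x | |birkhoffSum T (phasePotential A (Φ + bump T Q L n)) n x| ≤ n * (3 * ε)} ∪ D := by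
    intro x hx
    simp only [Set.mem_iUnion, exists_prop, Finset.mem_Ico] at hx
    obtain ⟨i, ⟨hi, hiv⟩, hxi⟩ := hx
    refine or_iff_not_imp_right.2 fun hxD => Set.mem_ofPred.2 ?_
    obtain ⟨m, hm⟩ := Nat.exists_eq_add_of_le' (show i ≤ n by grind)
    have hsum := birkhoffSum_phasePotential_add_bump hQ hQA hL hnL hH Φ hxi (i := i) (by omega)
    rw [iterate_symm_iterate, hm, Nat.add_sub_cancel, ← hm] at hsum
    have hnm : (n : ℝ) ≤ 2 * v + 2 * m := by exact_mod_cast (show n ≤ 2 * v + 2 * m by grind)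
    have hmn : (2 : ℝ) * m ≤ n := by exact_mod_cast (show 2 * m ≤ n by grind)
    rw [hsum]
    exact abs_sub_two_mul_le (hD n (by grind) x hxD) (hD m (by grind) x hxD) hlam hε hmn
      (by linarith)
  have hlevels := hQ.measureReal_biUnion_levels hT hQc (s := Finset.Ico (s * v) (s * v + v))
    fun i hi => by grind
  rw [Nat.card_Ico, Nat.add_sub_cancel_left] at hlevels
  exact hlevels.symm.trans_le
    ((measureReal_mono hsub (measure_ne_top _ _)).trans (measureReal_union_le _ _))

theorem IsTowerBase.mul_measureReal_le_one [IsProbabilityMeasure μ] (hQ : IsTowerBase T H Q)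
    (hT : MeasurePreserving T μ μ) (hQc : IsClopen Q) : H * μ.real Q ≤ 1 := by
  have hlevels := hQ.measureReal_biUnion_levels hT hQc (s := Finset.range H)
    fun i hi => Finset.mem_range.1 hi
  rw [Finset.card_range] at hlevels
  exact hlevels.symm.trans_le measureReal_le_one

theorem exists_isPhase_le_measureReal_abs_birkhoffSum_add_le [IsProbabilityMeasure μ]
    (hT : Ergodic T μ) (hA : IsClopen A) (hpos : μ A ≠ 0) (havoid : ∀ L, μ (avoidSet T A L) ≠ 0)
    {Φ : X → ℝ} (hΦ : Measurable Φ) {u : ℕ → ℝ} (hu : Tendsto u atTop (𝓝 0)) {a δ : ℝ}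
    (ha : 0 < a) (hδ : 0 < δ) (N : ℕ) :
    ∃ (ψ : X → ℝ) (n : ℕ), IsPhase T A ψ ∧ (∀ x, |ψ (T x) - ψ x| ≤ δ) ∧
      μ.real (Function.support ψ) ≤ δ ∧ N ≤ n ∧
      2 * u n ≤ μ.real {x | |birkhoffSum T (phasePotential A (Φ + ψ)) n x| ≤ n * a} := by
  obtain ⟨ε, rfl⟩ : ∃ ε, a = 3 * ε := ⟨a / 3, by ring⟩
  have hε : 0 < ε := by linarith
  have hTm := hT.toMeasurePreserving
  have hAm := hA.isOpen.measurableSet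
  obtain ⟨L, hL⟩ := exists_nat_gt (Real.pi / 2 / δ)
  obtain ⟨s, hs⟩ := exists_nat_ge (max 2 (1 / ε))
  obtain ⟨K, hK⟩ := exists_nat_ge (max 2 (1 / δ))
  rw [max_le_iff, Nat.ofNat_le_cast, div_le_iff₀ ‹_›] at hs hK
  have hL0 : 0 < L := Nat.cast_pos.1 ((by positivity : 0 ≤ Real.pi / 2 / δ).trans_lt hL)
  obtain ⟨c, hc, htower⟩ := exists_isTowerBase_subset_avoidSet hT T.continuous hA hpos havoid L
    (2 * s) (K := K * (4 * s)) (Nat.mul_pos (by omega) (by omega))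
  obtain ⟨D, hDη, N₀, hD⟩ := exists_forall_notMem_abs_birkhoffSum_sub_le hT
    (measurable_phasePotential hAm hΦ) (integrable_phasePotential hAm hΦ)
    hε (half_pos hc)
  obtain ⟨N₁, hN₁⟩ := eventually_atTop.1 (hu.eventually_le_const (by positivity : 0 < c / 4))
  obtain ⟨v, hv, Q, hQA, hQc, hQ, hcv⟩ := htower (N + N₀ + N₁ + L + 1)
  have hvn : 2 * v ≤ 2 * s * v := Nat.mul_le_mul_right v (by omega)
  have hH : 2 * (4 * s * v) ≤ K * (4 * s) * v := by
    rw [mul_assoc K]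
    exact Nat.mul_le_mul_right _ hK.1
  have hH' : 2 * (2 * s * v) = 4 * s * v := by ring
  refine ⟨bump T Q L (2 * s * v), 2 * s * v, isPhase_bump hQc hQ hQA hL0 (by omega), fun x => ?_,
    ?_, by omega, ?_⟩
  · refine (abs_bump_map_sub_le hQ (by omega) x).trans ?_
    exact (div_le_comm₀ (by positivity) hδ).2 hL.le
  · refine (measureReal_support_bump_le hTm hQc L _).trans ?_
    have hone := hQ.mul_measureReal_le_one hTm hQc
    have hLn : (L : ℝ) ≤ (2 * s * v : ℕ) := by exact_mod_cast (by omega : L ≤ 2 * s * v)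
    push_cast at hone hLn ⊢
    nlinarith [mul_le_mul_of_nonneg_right hLn (measureReal_nonneg (μ := μ) (s := Q))]
  · have hdev := le_measureReal_abs_birkhoffSum_add_bump_le hTm hQc hQ hQA hL0 (by omega) (by omega)
      hD (abs_integral_phasePotential_le A Φ) hε.le hs.1 hs.2 (by omega) rfl
    linarith [hN₁ (2 * s * v) (by omega)]

end Perturbation

section Series

/-- A sequence of angles whose increments along `T` and whose supports are controlled by a sequence
`δ` that at least halves at each step, so that both are summable. -/
structure IsPhaseSeries {X : Type*} [TopologicalSpace X] [MeasurableSpace X] (T : X → X)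
    (μ : Measure X) (A : Set X) (ψ : ℕ → X → ℝ) (δ : ℕ → ℝ) : Prop where
  isPhase : ∀ j, IsPhase T A (ψ j)
  pos : ∀ j, 0 < δ j
  succ_le : ∀ j, δ (j + 1) ≤ δ j / 2
  abs_sub_le : ∀ j x, |ψ j (T x) - ψ j x| ≤ δ j
  measureReal_support_le : ∀ j, μ.real (Function.support (ψ j)) ≤ δ j

variable {X : Type*} [TopologicalSpace X] [MeasurableSpace X] [OpensMeasurableSpace X]
  {μ : Measure X} [IsProbabilityMeasure μ] {T : X ≃ₜ X} {A : Set X}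

theorem exists_isPhaseSeries (hT : Ergodic T μ) (hA : IsClopen A) (hpos : μ A ≠ 0)
    (havoid : ∀ L, μ (avoidSet T A L) ≠ 0) {u : ℕ → ℝ} (hu_pos : ∀ n, 0 < u n)
    (hu : Tendsto u atTop (𝓝 0)) {a δ₀ : ℝ} (ha : 0 < a) (hδ₀ : 0 < δ₀) :
    ∃ (ψ : ℕ → X → ℝ) (δ : ℕ → ℝ) (n : ℕ → ℕ), IsPhaseSeries T μ A ψ δ ∧ δ 0 = δ₀ ∧
      ∀ i, i ≤ n i ∧ n i * (2 * δ (i + 1)) ≤ u (n i) ∧ 2 * u (n i) ≤ μ.real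
        {x | |birkhoffSum T (phasePotential A (∑ j ∈ Finset.range (i + 1), ψ j)) (n i) x| ≤
          n i * a} := by
  choose ψ n hψ hsub hsupp hn hdev using fun (s : {Φ : X → ℝ // Measurable Φ} × {δ : ℝ // 0 < δ}) =>
    exists_isPhase_le_measureReal_abs_birkhoffSum_add_le hT hA hpos havoid s.1.2 hu ha s.2.2
  -- Stage `i`: the sum of the angles chosen so far and the bound imposed on the next one.
  let S : ℕ → {Φ : X → ℝ // Measurable Φ} × {δ : ℝ // 0 < δ} := fun i =>
    Nat.rec (⟨0, measurable_zero⟩, ⟨δ₀, hδ₀⟩)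
      (fun i s => (⟨s.1 + ψ s i, s.1.2.add (hψ s i).continuous.measurable⟩,
        ⟨min (s.2 / 2) (u (n s i) / (2 * (n s i + 1))),
          lt_min (half_pos s.2.2) (div_pos (hu_pos _) (by positivity))⟩)) i
  have hsum : ∀ i, ((S i).1 : X → ℝ) = ∑ j ∈ Finset.range i, ψ (S j) j := by
    intro i
    induction i with
    | zero => rfl
    | succ i ih => rw [Finset.sum_range_succ, ← ih]
  refine ⟨fun i => ψ (S i) i, fun i => (S i).2, fun i => n (S i) i,
    ⟨fun i => hψ _ _, fun i => (S i).2.2, fun i => min_le_left _ _, fun i => hsub _ _,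
      fun i => hsupp _ _⟩, rfl, fun i => ⟨hn _ _, ?_, ?_⟩⟩
  · have hδ : ((S (i + 1)).2 : ℝ) ≤ u (n (S i) i) / (2 * (n (S i) i + 1)) := min_le_right _ _
    rw [le_div_iff₀ (by positivity)] at hδ
    linarith [(S (i + 1)).2.2]
  · rw [← hsum]
    exact hdev (S i) i

end Series

section Matrices

/-- The rotations of the plane, as a character of the group of angles. -/
noncomputable def slRot : AddChar ℝ (Matrix.SpecialLinearGroup (Fin 2) ℝ) where
  toFun θ := ⟨!![Real.cos θ, -Real.sin θ; Real.sin θ, Real.cos θ], by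
    simp [Matrix.det_fin_two, ← sq]⟩
  map_zero_eq_one' := Subtype.ext <| by simp [Matrix.one_fin_two]
  map_add_eq_mul' θ θ' := Subtype.ext <| by
    change _ = !![_, _; _, _] * !![_, _; _, _]
    simp only [Matrix.mul_fin_two, Real.cos_add, Real.sin_add]
    ring_nf

/-- The one-parameter group of diagonal matrices with entries `exp s` and `exp (-s)`. -/
noncomputable def slDiag : AddChar ℝ (Matrix.SpecialLinearGroup (Fin 2) ℝ) where
  toFun s := ⟨!![Real.exp s, 0; 0, Real.exp (-s)], by simp [Matrix.det_fin_two, ← Real.exp_add]⟩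
  map_zero_eq_one' := Subtype.ext <| by simp [Matrix.one_fin_two]
  map_add_eq_mul' s s' := Subtype.ext <| by
    change _ = !![_, _; _, _] * !![_, _; _, _]
    simp [Real.exp_add, mul_comm]

theorem coe_slRot (θ : ℝ) : (slRot θ : Matrix (Fin 2) (Fin 2) ℝ) =
    !![Real.cos θ, -Real.sin θ; Real.sin θ, Real.cos θ] := rfl

theorem coe_slDiag (s : ℝ) : (slDiag s : Matrix (Fin 2) (Fin 2) ℝ) =
    !![Real.exp s, 0; 0, Real.exp (-s)] := rfl

theorem continuous_slRot : Continuous slRot := by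
  refine continuous_induced_rng.2 (continuous_matrix fun i j => ?_)
  fin_cases i <;> fin_cases j
  exacts [Real.continuous_cos, Real.continuous_sin.neg, Real.continuous_sin, Real.continuous_cos]

theorem continuous_slDiag : Continuous slDiag := by
  refine continuous_induced_rng.2 (continuous_matrix fun i j => ?_)
  fin_cases i <;> fin_cases j
  exacts [Real.continuous_exp, continuous_const, continuous_const,
    Real.continuous_exp.comp continuous_neg]

theorem slRot_mul_slDiag_cos_two_mul {θ : ℝ} (h : Real.sin (2 * θ) = 0) :
    slRot θ * slDiag (Real.cos (2 * θ)) = slDiag 1 * slRot θ := by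
  refine Subtype.ext ?_
  simp only [Matrix.SpecialLinearGroup.coe_mul, coe_slRot, coe_slDiag, Matrix.mul_fin_two]
  have hsc : Real.sin θ = 0 ∨ Real.cos θ = 0 := by simpa [Real.sin_two_mul] using h
  rcases hsc with hs | hc
  · rw [Real.cos_two_mul', Real.cos_sq', hs]
    simp [mul_comm]
  · rw [Real.cos_two_mul, hc]
    norm_num [mul_comm]

section Norm

open scoped Matrix.Norms.L2Operator

theorem slRot_mem_unitary (θ : ℝ) :
    (slRot θ : Matrix (Fin 2) (Fin 2) ℝ) ∈ unitary (Matrix (Fin 2) (Fin 2) ℝ) := by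
  have h := Real.sin_sq_add_cos_sq θ
  rw [← Matrix.unitaryGroup, Matrix.mem_unitaryGroup_iff']
  ext i j
  fin_cases i <;> fin_cases j <;>
    simp [coe_slRot, Matrix.mul_apply, Fin.sum_univ_two, Matrix.star_apply] <;> linarith

theorem norm_slDiag (s : ℝ) : ‖(slDiag s : Matrix (Fin 2) (Fin 2) ℝ)‖ = Real.exp |s| := by
  rw [coe_slDiag, ← Matrix.diagonal_vec2, Matrix.l2_opNorm_diagonal]
  refine le_antisymm ((pi_norm_le_iff_of_nonneg (Real.exp_pos _).le).2 fun i => ?_) ?_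
  · fin_cases i
    · simpa using le_abs_self s
    · simpa using neg_le_abs s
  · rcases abs_cases s with ⟨h, -⟩ | ⟨h, -⟩ <;> rw [h]
    · simpa using norm_le_pi_norm ![Real.exp s, Real.exp (-s)] 0
    · simpa using norm_le_pi_norm ![Real.exp s, Real.exp (-s)] 1

theorem slNorm_slRot_mul_slDiag_mul_slRot (a s b : ℝ) :
    slNorm (slRot a * slDiag s * slRot b) = Real.exp |s| := by
  change ‖((slRot a * slDiag s * slRot b : Matrix.SpecialLinearGroup (Fin 2) ℝ) :
    Matrix (Fin 2) (Fin 2) ℝ)‖ = _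
  rw [Matrix.SpecialLinearGroup.coe_mul, Matrix.SpecialLinearGroup.coe_mul,
    CStarRing.norm_mul_mem_unitary _ (slRot_mem_unitary b),
    CStarRing.norm_mem_unitary_mul _ (slRot_mem_unitary a), norm_slDiag]

end Norm

theorem cocycleIter_addChar {X G : Type*} [Monoid G] (T : X → X) (χ : AddChar ℝ G) (φ : X → ℝ)
    (n : ℕ) (x : X) : cocycleIter T (fun x => χ (φ x)) n x = χ (birkhoffSum T φ n x) := by
  induction n with
  | zero => simp [cocycleIter]
  | succ n ih => rw [cocycleIter, ih, birkhoffSum_succ, add_comm, AddChar.map_add_eq_mul]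

theorem cocycleIter_eq_conj {X G : Type*} [Group G] {T : X → X} {M D R : X → G} {x : X}
    (h : ∀ t : ℕ, M (T^[t] x) = R (T^[t + 1] x) * D (T^[t] x) * (R (T^[t] x))⁻¹) (n : ℕ) :
    cocycleIter T M n x = R (T^[n] x) * cocycleIter T D n x * (R x)⁻¹ := by
  induction n with
  | zero => simp [cocycleIter]
  | succ n ih => rw [cocycleIter, ih, h n, cocycleIter]; group

theorem logNormIter_eq_abs_birkhoffSum {X : Type*} {T : X → X}
    {M : X → Matrix.SpecialLinearGroup (Fin 2) ℝ} {θ φ : X → ℝ} {x : X}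
    (h : ∀ t : ℕ, M (T^[t] x) =
      slRot (θ (T^[t + 1] x)) * slDiag (φ (T^[t] x)) * (slRot (θ (T^[t] x)))⁻¹) (n : ℕ) :
    logNormIter T M n x = |birkhoffSum T φ n x| := by
  rw [logNormIter, cocycleIter_eq_conj (R := fun y => slRot (θ y)) (D := fun y => slDiag (φ y)) h,
    cocycleIter_addChar, ← AddChar.map_neg_eq_inv, slNorm_slRot_mul_slDiag_mul_slRot, Real.log_exp]

end Matrices

section Limit

/-- The union of the supports of the functions `ψ j` with `k ≤ j`. -/
def tailSupport {X : Type*} (ψ : ℕ → X → ℝ) (k : ℕ) : Set X := {x | ∃ j ≥ k, ψ j x ≠ 0}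

/-- The sum of a sequence of angles. Off the null set where infinitely many of them are nonzero it
is a finite sum; it is only measurable in general. -/
noncomputable def totalPhase {X : Type*} (ψ : ℕ → X → ℝ) (x : X) : ℝ := ∑' j, ψ j x

/-- The increment of `totalPhase ψ` along `T`, summed term by term so that it is continuous. -/
noncomputable def phaseIncrement {X : Type*} (T : X → X) (ψ : ℕ → X → ℝ) (x : X) : ℝ :=
  ∑' j, (ψ j (T x) - ψ j x)

/-- The cocycle with diagonal part `slDiag 1` on `A` and `1` off `A`, twisted by the rotation of
angle `phaseIncrement T ψ`. -/
noncomputable def phaseCocycle {X : Type*} (T : X → X) (A : Set X) (ψ : ℕ → X → ℝ) (x : X) :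
    Matrix.SpecialLinearGroup (Fin 2) ℝ :=
  slRot (phaseIncrement T ψ x) * slDiag (A.indicator 1 x)

section Tail

variable {X : Type*} {T : X → X} {ψ : ℕ → X → ℝ} {x : X} {k : ℕ}

theorem eq_zero_of_notMem_tailSupport (hx : x ∉ tailSupport ψ k) {j : ℕ} (hj : k ≤ j) :
    ψ j x = 0 :=
  not_not.1 fun h => hx ⟨j, hj, h⟩

theorem tailSupport_antitone (ψ : ℕ → X → ℝ) : Antitone (tailSupport ψ) :=
  fun _ _ hkl _ ⟨j, hj, h⟩ => ⟨j, hkl.trans hj, h⟩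

theorem tailSupport_eq_iUnion (ψ : ℕ → X → ℝ) (k : ℕ) :
    tailSupport ψ k = ⋃ j, Function.support (ψ (j + k)) := by
  ext x
  simp only [tailSupport, Set.mem_ofPred_eq, Set.mem_iUnion, Function.mem_support]
  exact ⟨fun ⟨j, hj, h⟩ => ⟨j - k, by rwa [Nat.sub_add_cancel hj]⟩,
    fun ⟨j, h⟩ => ⟨j + k, Nat.le_add_left k j, h⟩⟩

theorem totalPhase_eq_sum (hx : x ∉ tailSupport ψ k) :
    totalPhase ψ x = (∑ j ∈ Finset.range k, ψ j) x := by
  rw [Finset.sum_apply]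
  exact tsum_eq_sum fun j hj => eq_zero_of_notMem_tailSupport hx (by simpa using hj)

theorem phaseIncrement_eq_sub (hx : x ∉ tailSupport ψ k) (hTx : T x ∉ tailSupport ψ k) :
    phaseIncrement T ψ x = totalPhase ψ (T x) - totalPhase ψ x := by
  rw [totalPhase_eq_sum hx, totalPhase_eq_sum hTx, Finset.sum_apply, Finset.sum_apply,
    ← Finset.sum_sub_distrib]
  refine tsum_eq_sum fun j hj => ?_
  have hkj : k ≤ j := by simpa using hj
  rw [eq_zero_of_notMem_tailSupport hx hkj, eq_zero_of_notMem_tailSupport hTx hkj, sub_zero]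

theorem birkhoffSum_totalPhase_eq (A : Set X) {n : ℕ}
    (hx : x ∈ avoidSet T (tailSupport ψ k) n) :
    birkhoffSum T (phasePotential A (totalPhase ψ)) n x =
      birkhoffSum T (phasePotential A (∑ j ∈ Finset.range k, ψ j)) n x :=
  Finset.sum_congr rfl fun t ht =>
    phasePotential_congr A (totalPhase_eq_sum (hx t (Finset.mem_range.1 ht)))

end Tail

namespace IsPhaseSeries

variable {X : Type*} [TopologicalSpace X] [MeasurableSpace X] {T : X → X} {μ : Measure X}
  {A : Set X} {ψ : ℕ → X → ℝ} {δ : ℕ → ℝ}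

theorem le_mul_pow (h : IsPhaseSeries T μ A ψ δ) (k j : ℕ) : δ (j + k) ≤ δ k * (1 / 2) ^ j := by
  induction j with
  | zero => simp
  | succ j ih =>
    rw [Nat.add_right_comm, pow_succ]
    linarith [h.succ_le (j + k)]

theorem continuous_phaseIncrement (h : IsPhaseSeries T μ A ψ δ) (hT : Continuous T) :
    Continuous (phaseIncrement T ψ) :=
  continuous_tsum
    (fun j => ((h.isPhase j).continuous.comp hT).sub (h.isPhase j).continuous)
    (summable_geometric_two.mul_left (δ 0))
    fun j x => (h.abs_sub_le j x).trans (h.le_mul_pow 0 j)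

theorem continuous_phaseCocycle (h : IsPhaseSeries T μ A ψ δ) (hT : Continuous T)
    (hA : IsClopen A) : Continuous (phaseCocycle T A ψ) :=
  (continuous_slRot.comp (h.continuous_phaseIncrement hT)).mul
    (continuous_slDiag.comp (hA.continuous_indicator continuous_one))

theorem phaseCocycle_eq_conj (h : IsPhaseSeries T μ A ψ δ) {x : X} {k : ℕ}
    (hx : x ∉ tailSupport ψ k) (hTx : T x ∉ tailSupport ψ k) :
    phaseCocycle T A ψ x = slRot (totalPhase ψ (T x)) *
      slDiag (phasePotential A (totalPhase ψ) x) * (slRot (totalPhase ψ x))⁻¹ := by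
  have hinc := phaseIncrement_eq_sub hx hTx
  rw [eq_mul_inv_iff_mul_eq, phaseCocycle]
  by_cases hxA : x ∈ A
  · have hsum := IsPhase.sum h.isPhase (Finset.range k)
    have hsin := hsum.sin_two_mul_eq_zero x hxA
    have hmap := hsum.map_eq x hxA
    rw [← totalPhase_eq_sum hx] at hsin hmap
    rw [← totalPhase_eq_sum hTx] at hmap
    rw [hinc, hmap, sub_self, AddChar.map_zero_eq_one, one_mul, phasePotential,
      Set.indicator_of_mem hxA, Set.indicator_of_mem hxA, Pi.one_apply,
      slRot_mul_slDiag_cos_two_mul hsin]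
  · rw [phasePotential, Set.indicator_of_notMem hxA, Set.indicator_of_notMem hxA,
      AddChar.map_zero_eq_one, mul_one, mul_one, ← AddChar.map_add_eq_mul, hinc, sub_add_cancel]

theorem measureReal_tailSupport_le [IsFiniteMeasure μ] (h : IsPhaseSeries T μ A ψ δ) (k : ℕ) :
    μ.real (tailSupport ψ k) ≤ 2 * δ k := by
  have hδ := h.pos k
  have hgeom : HasSum (fun j : ℕ => δ k * (1 / 2) ^ j) (2 * δ k) := by
    simpa only [mul_comm] using hasSum_geometric_two.mul_left (δ k)
  refine ENNReal.toReal_le_of_le_ofReal (by positivity) ?_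
  calc μ (tailSupport ψ k)
    _ ≤ ∑' j, μ (Function.support (ψ (j + k))) := by
      rw [tailSupport_eq_iUnion]
      exact measure_iUnion_le _
    _ ≤ ∑' j, ENNReal.ofReal (δ k * (1 / 2) ^ j) := ENNReal.tsum_le_tsum fun j =>
      (ENNReal.le_ofReal_iff_toReal_le (measure_ne_top _ _) (by positivity)).2
        ((h.measureReal_support_le _).trans (h.le_mul_pow k j))
    _ = ENNReal.ofReal (2 * δ k) := by
      rw [← ENNReal.ofReal_tsum_of_nonneg (fun j => by positivity) hgeom.summable, hgeom.tsum_eq]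

theorem ae_exists_notMem_tailSupport [IsFiniteMeasure μ] (h : IsPhaseSeries T μ A ψ δ) :
    ∀ᵐ x ∂μ, ∃ k, x ∉ tailSupport ψ k := by
  have hle : ∀ k, μ.real (⋂ k, tailSupport ψ k) ≤ 2 * (δ 0 * (1 / 2) ^ k) := fun k =>
    (measureReal_mono (Set.iInter_subset _ k) (measure_ne_top _ _)).trans
      ((h.measureReal_tailSupport_le k).trans
        (mul_le_mul_of_nonneg_left (h.le_mul_pow 0 k) zero_le_two))
  have hlim : Tendsto (fun k : ℕ => 2 * (δ 0 * (1 / 2) ^ k)) atTop (𝓝 0) := by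
    simpa using ((tendsto_pow_atTop_nhds_zero_of_lt_one (by norm_num)
      (by norm_num : (1 / 2 : ℝ) < 1)).const_mul (δ 0)).const_mul 2
  have hnull : μ (⋂ k, tailSupport ψ k) = 0 :=
    (measureReal_eq_zero_iff (measure_ne_top _ _)).1
      (le_antisymm (ge_of_tendsto' hlim hle) measureReal_nonneg)
  filter_upwards [measure_eq_zero_iff_ae_notMem.1 hnull] with x hx
  simpa using hx

theorem ae_logNormIter_eq [IsFiniteMeasure μ] (h : IsPhaseSeries T μ A ψ δ)
    (hT : MeasurePreserving T μ μ) :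
    ∀ᵐ x ∂μ, ∀ n, logNormIter T (phaseCocycle T A ψ) n x =
      |birkhoffSum T (phasePotential A (totalPhase ψ)) n x| := by
  have horbit : ∀ᵐ x ∂μ, ∀ t : ℕ, ∃ k, T^[t] x ∉ tailSupport ψ k := ae_all_iff.2 fun t =>
    (hT.iterate t).quasiMeasurePreserving.ae h.ae_exists_notMem_tailSupport
  filter_upwards [horbit] with x hx n
  refine logNormIter_eq_abs_birkhoffSum (θ := totalPhase ψ) (fun t => ?_) n
  obtain ⟨k, hk⟩ := hx t
  obtain ⟨l, hl⟩ := hx (t + 1)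
  rw [Function.iterate_succ_apply'] at hl ⊢
  exact h.phaseCocycle_eq_conj (k := max k l)
    (fun hmem => hk (tailSupport_antitone ψ (le_max_left k l) hmem))
    (fun hmem => hl (tailSupport_antitone ψ (le_max_right k l) hmem))

variable [OpensMeasurableSpace X]

theorem measurableSet_tailSupport (h : IsPhaseSeries T μ A ψ δ) (k : ℕ) :
    MeasurableSet (tailSupport ψ k) := by
  rw [tailSupport_eq_iUnion]
  exact .iUnion fun j => (h.isPhase _).continuous.isOpen_support.measurableSet

theorem measurable_totalPhase (h : IsPhaseSeries T μ A ψ δ) : Measurable (totalPhase ψ) :=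
  Measurable.tsum fun j => (h.isPhase j).continuous.measurable

theorem isTopLyapunovExponent [IsProbabilityMeasure μ] (h : IsPhaseSeries T μ A ψ δ)
    (hT : Ergodic T μ) (hA : MeasurableSet A) :
    IsTopLyapunovExponent T μ (phaseCocycle T A ψ)
      |∫ x, phasePotential A (totalPhase ψ) x ∂μ| := by
  filter_upwards [h.ae_logNormIter_eq hT.toMeasurePreserving,
    ae_tendsto_birkhoffSum_div hT (integrable_phasePotential hA h.measurable_totalPhase)]
    with x hlog hlim
  simpa only [hlog, abs_div, Nat.abs_cast] using hlim.abs

theorem le_integral_phasePotential_totalPhase [IsFiniteMeasure μ] (h : IsPhaseSeries T μ A ψ δ)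
    (hA : MeasurableSet A) :
    μ.real A - 4 * δ 0 ≤ ∫ x, phasePotential A (totalPhase ψ) x ∂μ := by
  have hB := h.measurableSet_tailSupport 0
  have hiA : Integrable (A.indicator (1 : X → ℝ)) μ := (integrable_const 1).indicator hA
  have hiB : Integrable ((tailSupport ψ 0).indicator (1 : X → ℝ)) μ :=
    (integrable_const 1).indicator hB
  have hle : ∀ x, A.indicator (1 : X → ℝ) x - 2 * (tailSupport ψ 0).indicator (1 : X → ℝ) x ≤
      phasePotential A (totalPhase ψ) x := by
    intro x
    by_cases hx : x ∈ tailSupport ψ 0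
    · have hA1 : A.indicator (1 : X → ℝ) x ≤ 1 := Set.indicator_le_self' (by simp) x
      rw [Set.indicator_of_mem hx, Pi.one_apply]
      linarith [neg_le_of_abs_le (abs_phasePotential_le A (totalPhase ψ) x)]
    · have hzero : totalPhase ψ x = 0 := totalPhase_eq_sum hx
      by_cases hxA : x ∈ A <;> simp [phasePotential, hx, hxA, hzero]
  have hint := integral_mono (hiA.sub (hiB.const_mul 2))
    (integrable_phasePotential hA h.measurable_totalPhase) hle
  simp only [Pi.sub_apply] at hint
  rw [integral_sub hiA (hiB.const_mul 2), integral_const_mul, integral_indicator_one hA,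
    integral_indicator_one hB] at hint
  linarith [h.measureReal_tailSupport_le 0]

theorem measureReal_abs_birkhoffSum_le_le [IsFiniteMeasure μ] (h : IsPhaseSeries T μ A ψ δ)
    (hT : MeasurePreserving T μ μ) (k n : ℕ) (r : ℝ) :
    μ.real {x | |birkhoffSum T (phasePotential A (∑ j ∈ Finset.range k, ψ j)) n x| ≤ r} ≤
      μ.real {x | logNormIter T (phaseCocycle T A ψ) n x ≤ r} + n * (2 * δ k) := by
  have hcompl : μ.real (⋃ t ∈ Finset.range n, T^[t] ⁻¹' tailSupport ψ k) ≤ n * (2 * δ k) := by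
    refine (measureReal_biUnion_finset_le _ _).trans ?_
    simp only [measureReal_preimage_iterate hT (h.measurableSet_tailSupport k), Finset.sum_const,
      Finset.card_range, nsmul_eq_mul]
    exact mul_le_mul_of_nonneg_left (h.measureReal_tailSupport_le k) n.cast_nonneg
  have hsub : {x | |birkhoffSum T (phasePotential A (∑ j ∈ Finset.range k, ψ j)) n x| ≤ r} ≤ᵐ[μ]
      ({x | logNormIter T (phaseCocycle T A ψ) n x ≤ r} ∪
        ⋃ t ∈ Finset.range n, T^[t] ⁻¹' tailSupport ψ k : Set X) := by
    filter_upwards [h.ae_logNormIter_eq hT] with x hlog hx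
    refine or_iff_not_imp_right.2 fun hmem => ?_
    have havoid : x ∈ avoidSet T (tailSupport ψ k) n := by simpa [avoidSet] using hmem
    rw [Set.mem_ofPred_eq, hlog, birkhoffSum_totalPhase_eq A havoid]
    exact hx
  exact (ENNReal.toReal_mono (measure_ne_top _ _) (measure_mono_ae hsub)).trans
    ((measureReal_union_le _ _).trans (add_le_add_right hcompl _))

theorem ofReal_le_measure_logNormIter_le [IsFiniteMeasure μ] (h : IsPhaseSeries T μ A ψ δ)
    (hT : MeasurePreserving T μ μ) {k n : ℕ} {r s u : ℝ} (hrs : r ≤ s) (hδ : n * (2 * δ k) ≤ u)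
    (hu : 2 * u ≤
      μ.real {x | |birkhoffSum T (phasePotential A (∑ j ∈ Finset.range k, ψ j)) n x| ≤ r}) :
    ENNReal.ofReal u ≤ μ {x | logNormIter T (phaseCocycle T A ψ) n x ≤ s} := by
  have hdev := h.measureReal_abs_birkhoffSum_le_le hT k n r
  have hmono : μ.real {x | logNormIter T (phaseCocycle T A ψ) n x ≤ r} ≤
      μ.real {x | logNormIter T (phaseCocycle T A ψ) n x ≤ s} :=
    measureReal_mono fun x hx => le_trans hx hrs
  exact ENNReal.ofReal_le_of_le_toReal (show u ≤ μ.real _ by linarith)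

end IsPhaseSeries

end Limit

theorem not_hasExpLargeDeviations_of_frequently {X : Type*} [MeasurableSpace X] {μ : Measure X}
    {f : ℕ → X → ℝ} {lam : ℝ} (hlam : 0 < lam) {u : ℕ → ℝ}
    (hfreq : ∃ᶠ n : ℕ in atTop, ENNReal.ofReal (u n) ≤ μ {x | f n x ≤ n * lam / 2})
    (hu : ∀ c : ℝ, 0 < c → Tendsto (fun n : ℕ => u n * Real.exp (c * n)) atTop atTop) :
    ¬ HasExpLargeDeviations μ f lam := by
  intro hexp
  obtain ⟨C, hC, hbound⟩ := hexp (lam / 2) (by positivity)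
  obtain ⟨n, hdev, hgt⟩ := (hfreq.and_eventually
    ((hu C⁻¹ (by positivity)).eventually_gt_atTop C)).exists
  have hsub : {x | f n x ≤ n * lam / 2} ⊆ {x | |f n x - n * lam| ≥ n * (lam / 2)} := by
    intro x hx
    rw [Set.mem_ofPred_eq] at hx ⊢
    linarith [neg_le_abs (f n x - n * lam)]
  have hle := (hdev.trans (measure_mono hsub)).trans (hbound n)
  rw [ENNReal.ofReal_le_ofReal_iff (by positivity), Real.exp_neg, ← div_eq_mul_inv,
    le_div_iff₀ (Real.exp_pos _)] at hle
  exact hgt.not_ge hle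

theorem theoremA3_general {X : Type*} [TopologicalSpace X] [MeasurableSpace X]
    [OpensMeasurableSpace X] {T : X ≃ₜ X} {μ : Measure X} [IsProbabilityMeasure μ]
    (hT : Ergodic T μ) {A : Set X} (hA : IsClopen A) (hpos : μ A ≠ 0)
    (havoid : ∀ L, μ (avoidSet T A L) ≠ 0) {u : ℕ → ℝ} (hu_pos : ∀ n, 0 < u n)
    (hu_lim : Tendsto u atTop (𝓝 0)) :
    ∃ (M : X → Matrix.SpecialLinearGroup (Fin 2) ℝ) (lam : ℝ),
      Continuous M ∧
      IsTopLyapunovExponent T μ M lam ∧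
      0 < lam ∧
      (∃ᶠ n : ℕ in atTop, ENNReal.ofReal (u n) ≤ μ {x | logNormIter T M n x ≤ n * lam / 2}) ∧
      ((∀ c : ℝ, 0 < c → Tendsto (fun n : ℕ => u n * Real.exp (c * n)) atTop atTop) →
        ¬ HasExpLargeDeviations μ (logNormIter T M) lam) := by
  have hα : 0 < μ.real A := ENNReal.toReal_pos hpos (measure_ne_top _ _)
  obtain ⟨ψ, δ, n, h, hδ, hn⟩ := exists_isPhaseSeries hT hA hpos havoid hu_pos hu_lim
    (show 0 < μ.real A / 4 by positivity) (show 0 < μ.real A / 8 by positivity)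
  set lam := |∫ x, phasePotential A (totalPhase ψ) x ∂μ|
  have hlam : μ.real A / 2 ≤ lam := by
    have hint := h.le_integral_phasePotential_totalPhase hA.isOpen.measurableSet
    rw [hδ] at hint
    exact le_trans (by linarith) (hint.trans (le_abs_self _))
  have hlam_pos : 0 < lam := by linarith
  have hfreq : ∃ᶠ k : ℕ in atTop, ENNReal.ofReal (u k) ≤
      μ {x | logNormIter T (phaseCocycle T A ψ) k x ≤ k * lam / 2} := by
    refine frequently_atTop.2 fun i => ⟨n i, (hn i).1, ?_⟩
    refine h.ofReal_le_measure_logNormIter_le hT.toMeasurePreserving ?_ (hn i).2.1 (hn i).2.2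
    rw [mul_div_assoc]
    exact mul_le_mul_of_nonneg_left (by linarith) (n i).cast_nonneg
  exact ⟨phaseCocycle T A ψ, lam, h.continuous_phaseCocycle T.continuous hA,
    h.isTopLyapunovExponent hT hA.isOpen.measurableSet, hlam_pos, hfreq,
    not_hasExpLargeDeviations_of_frequently hlam_pos hfreq⟩

/-- `twoShiftMap` as a homeomorphism, the form of the dynamics used by `theoremA3_general`. -/
def twoShift : TwoShift ≃ₜ TwoShift where
  toFun := twoShiftMap
  invFun x k := x (k - 1)
  left_inv x := funext fun k => congrArg x (sub_add_cancel k 1)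
  right_inv x := funext fun k => congrArg x (add_sub_cancel_right k 1)
  continuous_toFun := continuous_pi fun k => continuous_apply (k + 1)
  continuous_invFun := continuous_pi fun k => continuous_apply (k - 1)

theorem isClopen_coord_zero_eq_one : IsClopen {x : TwoShift | x 0 = 1} :=
  (isClopen_discrete {1}).preimage (continuous_apply (0 : ℤ))

theorem measure_avoidSet_twoShift_ne_zero (μ : Measure TwoShift) [μ.IsOpenPosMeasure] (L : ℕ) :
    μ (avoidSet twoShift {x | x 0 = 1} L) ≠ 0 :=
  (isClopen_avoidSet twoShift.continuous isClopen_coord_zero_eq_one L).isOpen.measure_ne_zero μ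
    ⟨0, fun k _ => by
      have hfix : twoShift^[k] 0 = 0 := Function.iterate_fixed rfl k
      rw [hfix]
      exact zero_ne_one⟩

theorem theoremA3 (μ : Measure TwoShift) [IsProbabilityMeasure μ] [μ.IsOpenPosMeasure]
    (hμ : Ergodic twoShiftMap μ)
    (u : ℕ → ℝ) (hu_pos : ∀ n, 0 < u n) (hu_lim : Tendsto u atTop (𝓝 0)) :
    ∃ (M : TwoShift → Matrix.SpecialLinearGroup (Fin 2) ℝ) (lam : ℝ),
      Continuous M ∧
      IsTopLyapunovExponent twoShiftMap μ M lam ∧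
      0 < lam ∧
      (∃ᶠ n : ℕ in atTop,
        ENNReal.ofReal (u n) ≤ μ {x | logNormIter twoShiftMap M n x ≤ n * lam / 2}) ∧
      ((∀ c : ℝ, 0 < c → Tendsto (fun n : ℕ => u n * Real.exp (c * n)) atTop atTop) →
        ¬ HasExpLargeDeviations μ (logNormIter twoShiftMap M) lam) :=
  theoremA3_general (T := twoShift) hμ isClopen_coord_zero_eq_one
    (isClopen_coord_zero_eq_one.isOpen.measure_ne_zero μ ⟨fun _ => 1, rfl⟩)
    (measure_avoidSet_twoShift_ne_zero μ) hu_pos hu_lim
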